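/- Let $K$ be a field of characteristic different from $2$ and $3$, and let $\mathbb O$ be an octonion algebra over $K$, that is, the (nonassociative, unital, $8$-dimensional) algebra $\mathbb O = \mathbb H \oplus \mathbb H\ell$ obtained by the Cayley–Dickson process with a parameter $c \in K$, $c\neq 0$, from a quaternion algebra $\mathbb H$ over $K$ with basis $1,i,j,ij$, where $i^2=a$, $j^2=b$, $ij=-ji$, $a,b\in K$, $ab\ne 0$; explicitly, $(p+q\ell)(r+s\ell) = (pr + c\,\overline{s}q) + (sp + q\overline{r})\ell$, with conjugation $\overline{p+q\ell} = \overline p - q\ell$. (The split octonion algebra is the one with $c = 1$ and arbitrary nonzero $a,b$; the algebra with a standard basis $1,e_1,\dots,e_7$, $e_i^2=-1$, $e_ie_j=-e_je_i$ for $i\neq j$, is the one with $a=b=c=-1$.) For $n\ge 0$ let $J$ be the involution $(a_{ij})\mapsto(\overline{a_{ji}})$ of the algebra $M_n(\mathbb O)$ of $n\times n$ matrices over $\mathbb O$. Let $\mathrm{Sym}^+ = \{X : J(X)=X\}$ be the algebra of Hermitian matrices with the product $X\circ Y=\frac12(XY+YX)$, and let $\mathrm{Sym}^-=\{X : J(X)=-X\}$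 be the algebra of skew-Hermitian matrices with the product $[X,Y]=XY-YX$. For a matrix $X = (a_{ij})$ write $\overline X=(\overline{a_{ij}})$. A symmetric bilinear form $\varphi: A\times A\to K$ on an algebra $A$ is called associative if $\varphi(xy,z)=\varphi(x,yz)$ for all $x,y,z\in A$, where $xy$ denotes the product of the algebra $A$. Let $A$ be either of the algebras $\mathrm{Sym}^+$, $\mathrm{Sym}^-$. Then $$ (X,Y)\mapsto \mathrm{Tr}\bigl(XY+\overline{XY}\bigr), $$ where $XY$ is the product in $M_n(\mathbb O)$, takes values in $K = K1\subseteq\mathbb O$ and is a symmetric bilinear associative form on $A$, and any symmetric bilinear associative form $A\times A\to K$ is a scalar multiple of it. -/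

import Mathlib

open scoped Quaternion

/-- The octonion algebra over `K` with nonzero parameters `a`, `b`, `c`: the Cayley-Dickson double
`ℍ ⊕ ℍ l`, `l ^ 2 = c`, of the quaternion algebra `ℍ = ℍ[K,a,b]` with `i ^ 2 = a`, `j ^ 2 = b`,
`i * j = - j * i`. The element `p + q l` is stored as the pair `(p, q)`. In characteristic
different from 2, with `a`, `b`, `c` ranging over the nonzero elements of `K`, these are exactly
the octonion algebras over `K` up to isomorphism; the split one is obtained for `c = 1` (and any
nonzero `a`, `b`), and the one with a basis `1, e₁, …, e₇` of pairwise anticommuting `eᵢ` with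
`eᵢ ^ 2 = -1` is obtained for `a = b = c = -1`. -/
def OctonionAlgebra (K : Type*) [CommRing K] (a b _c : K) : Type _ := ℍ[K,a,b] × ℍ[K,a,b]

namespace OctonionAlgebra

variable {K : Type*} [CommRing K] {a b c : K}

instance : AddCommGroup (OctonionAlgebra K a b c) :=
  inferInstanceAs (AddCommGroup (ℍ[K,a,b] × ℍ[K,a,b]))

instance : Module K (OctonionAlgebra K a b c) :=
  inferInstanceAs (Module K (ℍ[K,a,b] × ℍ[K,a,b]))

/-- The unit `1 = 1 + 0 l`. -/
instance : One (OctonionAlgebra K a b c) := ⟨((1, 0) : ℍ[K,a,b] × ℍ[K,a,b])⟩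

/-- `(p + q l) (r + s l) = (p r + c s̄ q) + (s p + q r̄) l`. -/
instance : Mul (OctonionAlgebra K a b c) :=
  ⟨fun x y => ((x.1 * y.1 + c • (star y.2 * x.2), y.2 * x.1 + x.2 * star y.1) :
    ℍ[K,a,b] × ℍ[K,a,b])⟩

/-- The standard conjugation `p + q l ↦ p̄ - q l`. -/
instance : Star (OctonionAlgebra K a b c) :=
  ⟨fun x => ((star x.1, -x.2) : ℍ[K,a,b] × ℍ[K,a,b])⟩

@[ext] theorem ext {x y : OctonionAlgebra K a b c} (h₁ : x.1 = y.1) (h₂ : x.2 = y.2) : x = y :=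
  Prod.ext h₁ h₂

@[simp] theorem fst_zero : (0 : OctonionAlgebra K a b c).1 = 0 := rfl
@[simp] theorem snd_zero : (0 : OctonionAlgebra K a b c).2 = 0 := rfl
@[simp] theorem fst_one : (1 : OctonionAlgebra K a b c).1 = 1 := rfl
@[simp] theorem snd_one : (1 : OctonionAlgebra K a b c).2 = 0 := rfl
@[simp] theorem fst_add (x y : OctonionAlgebra K a b c) : (x + y).1 = x.1 + y.1 := rfl
@[simp] theorem snd_add (x y : OctonionAlgebra K a b c) : (x + y).2 = x.2 + y.2 := rfl
@[simp] theorem fst_smul (t : K) (x : OctonionAlgebra K a b c) : (t • x).1 = t • x.1 := rfl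
@[simp] theorem snd_smul (t : K) (x : OctonionAlgebra K a b c) : (t • x).2 = t • x.2 := rfl
@[simp] theorem fst_mul (x y : OctonionAlgebra K a b c) :
    (x * y).1 = x.1 * y.1 + c • (star y.2 * x.2) := rfl
@[simp] theorem snd_mul (x y : OctonionAlgebra K a b c) :
    (x * y).2 = y.2 * x.1 + x.2 * star y.1 := rfl
@[simp] theorem fst_star (x : OctonionAlgebra K a b c) : (star x).1 = star x.1 := rfl
@[simp] theorem snd_star (x : OctonionAlgebra K a b c) : (star x).2 = -x.2 := rfl

instance : NonAssocRing (OctonionAlgebra K a b c) :=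
  { (inferInstance : AddCommGroup (OctonionAlgebra K a b c)),
    (inferInstance : Mul (OctonionAlgebra K a b c)),
    (inferInstance : One (OctonionAlgebra K a b c)) with
    left_distrib := fun x y z => by
      ext1 <;> simp [mul_add, add_mul, smul_add] <;> abel
    right_distrib := fun x y z => by
      ext1 <;> simp [mul_add, add_mul, smul_add] <;> abel
    zero_mul := fun x => by ext1 <;> simp
    mul_zero := fun x => by ext1 <;> simp
    one_mul := fun x => by ext1 <;> simp
    mul_one := fun x => by ext1 <;> simp }

theorem star_smul' (t : K) (x : OctonionAlgebra K a b c) : star (t • x) = t • star x := by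
  ext1
  · simp [QuaternionAlgebra.star_smul]
  · simp

instance : StarRing (OctonionAlgebra K a b c) where
  star_involutive x := by ext1 <;> simp
  star_add x y := by ext1 <;> simp [add_comm]
  star_mul x y := by
    ext1
    · simp [QuaternionAlgebra.star_smul]
    · simp [add_comm]

end OctonionAlgebra

section MatrixAlgebras

variable (K : Type*) [Field K] (a b c : K) (n : ℕ)

/-- The `n × n` matrices over the octonion algebra. The star on matrices, `Xᴴ`, is
`(xᵢⱼ) ↦ (x̄ⱼᵢ)`, that is, the involution `J`. -/
abbrev OctonionMatrix : Type _ := Matrix (Fin n) (Fin n) (OctonionAlgebra K a b c)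

variable {K a b c n} in
theorem OctonionMatrix.conjTranspose_smul' (t : K) (X : OctonionMatrix K a b c n) :
    (t • X).conjTranspose = t • X.conjTranspose :=
  Matrix.ext fun i j => OctonionAlgebra.star_smul' t (X j i)

/-- The space of Hermitian octonionic matrices, `Sym⁺(Mₙ(𝕆), J)`. -/
def hermitianOct : Submodule K (OctonionMatrix K a b c n) where
  carrier := {X | X.conjTranspose = X}
  add_mem' {X Y} hX hY := by
    simp only [Set.mem_ofPred_eq] at *
    rw [Matrix.conjTranspose_add, hX, hY]
  zero_mem' := Matrix.conjTranspose_zero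
  smul_mem' t X hX := by
    simp only [Set.mem_ofPred_eq] at *
    rw [OctonionMatrix.conjTranspose_smul', hX]

/-- The space of skew-Hermitian octonionic matrices, `Sym⁻(Mₙ(𝕆), J)`. -/
def skewHermitianOct : Submodule K (OctonionMatrix K a b c n) where
  carrier := {X | X.conjTranspose = -X}
  add_mem' {X Y} hX hY := by
    simp only [Set.mem_ofPred_eq] at *
    rw [Matrix.conjTranspose_add, hX, hY, neg_add]
  zero_mem' := by simp
  smul_mem' t X hX := by
    simp only [Set.mem_ofPred_eq] at *
    rw [OctonionMatrix.conjTranspose_smul', hX, smul_neg]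

variable {K a b c n}

/-- The algebra of Hermitian matrices: the product is `X ∘ Y = ½ (X Y + Y X)`. -/
instance : Mul (hermitianOct K a b c n) where
  mul X Y := ⟨(2 : K)⁻¹ • (X.1 * Y.1 + Y.1 * X.1), by
    refine Submodule.smul_mem _ _ ?_
    have hX : (X : OctonionMatrix K a b c n).conjTranspose = X := X.2
    have hY : (Y : OctonionMatrix K a b c n).conjTranspose = Y := Y.2
    change Matrix.conjTranspose _ = _
    rw [Matrix.conjTranspose_add, Matrix.conjTranspose_mul, Matrix.conjTranspose_mul, hX, hY,
      add_comm]⟩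

/-- The algebra of skew-Hermitian matrices: the product is `[X, Y] = X Y - Y X`. -/
instance : Mul (skewHermitianOct K a b c n) where
  mul X Y := ⟨X.1 * Y.1 - Y.1 * X.1, by
    have hX : (X : OctonionMatrix K a b c n).conjTranspose = -X := X.2
    have hY : (Y : OctonionMatrix K a b c n).conjTranspose = -Y := Y.2
    change Matrix.conjTranspose _ = _
    rw [Matrix.conjTranspose_sub, Matrix.conjTranspose_mul, Matrix.conjTranspose_mul, hX, hY,
      neg_mul_neg, neg_mul_neg, neg_sub]⟩

/-- The entrywise conjugate `X̄ = (x̄ᵢⱼ)`. -/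
def OctonionMatrix.conj (X : OctonionMatrix K a b c n) : OctonionMatrix K a b c n :=
  X.map star

/-- The octonion `Tr(X Y + \overline{X Y})`, which is a scalar (a multiple of `1`). -/
def OctonionMatrix.traceForm (X Y : OctonionMatrix K a b c n) : OctonionAlgebra K a b c :=
  Matrix.trace (X * Y + OctonionMatrix.conj (X * Y))

end MatrixAlgebras

/-- `φ` is a symmetric associative form: `φ(x, y) = φ(y, x)` and `φ(x y, z) = φ(x, y z)`. -/
def IsSymmAssocForm {K A : Type*} [Field K] [AddCommGroup A] [Module K A] [Mul A]
    (φ : LinearMap.BilinForm K A) : Prop :=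
  (∀ x y, φ x y = φ y x) ∧ ∀ x y z, φ (x * y) z = φ x (y * z)

/-! ### Trace and commutator identities in the octonions. -/

namespace OctonionAlgebra

variable {K : Type*} [CommRing K] {a b c : K}

/-! The octonions are not associative, but their trace is commutative and associative
(`tr_mul_comm`, `tr_mul_assoc`). Hence the matrix trace form is symmetric and associative on all of
`Mₙ(𝕆)`, and so for both symmetrized products.

For uniqueness, subtract a multiple of the trace form so that the given form `φ` vanishes at one
diagonal pair `(e, e)`; it then suffices to show `φ = 0`. Check this on the matrices supported at
positions `ij` and `ji`. A diagonal element at `i` acts invertibly on the off-diagonal `ij` space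
and kills everything that avoids the index `i`, so associativity makes spaces with different index
pairs orthogonal. Products of two `ij` elements are diagonal, which reduces the off-diagonal values
to diagonal ones and carries vanishing from one diagonal place to all others.

In the Hermitian case each diagonal place is one-dimensional. In the skew case it is the commutator
algebra of imaginary octonions, where `exists_imI_double_commutator` gives uniqueness of the form.
-/

instance : IsScalarTower K (OctonionAlgebra K a b c) (OctonionAlgebra K a b c) where
  smul_assoc t x y := by
    ext1 <;> simp [smul_add, smul_comm c t]

instance : SMulCommClass K (OctonionAlgebra K a b c) (OctonionAlgebra K a b c) where
  smul_comm t x y := by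
    ext1 <;> simp [smul_add, smul_comm c t, QuaternionAlgebra.star_smul]

/-- The trace `x ↦ x + x̄`, as a scalar. -/
def tr : OctonionAlgebra K a b c →ₗ[K] K where
  toFun x := 2 * x.1.re
  map_add' x y := by simp [mul_add]
  map_smul' t x := by simp [mul_left_comm]

theorem tr_apply (x : OctonionAlgebra K a b c) : tr x = 2 * x.1.re := rfl

theorem tr_smul_one (x : OctonionAlgebra K a b c) :
    tr x • (1 : OctonionAlgebra K a b c) = x + star x := by
  ext <;> simp [tr_apply, two_mul]

theorem tr_mul_comm (x y : OctonionAlgebra K a b c) : tr (x * y) = tr (y * x) := by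
  simp [tr_apply]; ring

theorem tr_mul_assoc (x y z : OctonionAlgebra K a b c) : tr (x * y * z) = tr (x * (y * z)) := by
  simp [tr_apply]; ring

variable (K a b c) in
/-- The imaginary unit `i` of the quaternion algebra, as an octonion. -/
def imI : OctonionAlgebra K a b c := ((⟨0, 1, 0, 0⟩, 0) : ℍ[K,a,b] × ℍ[K,a,b])

variable (K a b c) in
/-- The imaginary unit `j` of the quaternion algebra, as an octonion. -/
def imJ : OctonionAlgebra K a b c := ((⟨0, 0, 1, 0⟩, 0) : ℍ[K,a,b] × ℍ[K,a,b])

variable (K a b c) in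
/-- The imaginary unit `i j` of the quaternion algebra, as an octonion. -/
def imK : OctonionAlgebra K a b c := ((⟨0, 0, 0, 1⟩, 0) : ℍ[K,a,b] × ℍ[K,a,b])

@[simp] theorem fst_neg (x : OctonionAlgebra K a b c) : (-x).1 = -x.1 := rfl
@[simp] theorem snd_neg (x : OctonionAlgebra K a b c) : (-x).2 = -x.2 := rfl
@[simp] theorem fst_sub (x y : OctonionAlgebra K a b c) : (x - y).1 = x.1 - y.1 := by
  rw [sub_eq_add_neg, fst_add, fst_neg, sub_eq_add_neg]
@[simp] theorem snd_sub (x y : OctonionAlgebra K a b c) : (x - y).2 = x.2 - y.2 := by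
  rw [sub_eq_add_neg, snd_add, snd_neg, sub_eq_add_neg]
@[simp] theorem fst_imI : (imI K a b c).1 = ⟨0, 1, 0, 0⟩ := rfl
@[simp] theorem snd_imI : (imI K a b c).2 = 0 := rfl
@[simp] theorem fst_imJ : (imJ K a b c).1 = ⟨0, 0, 1, 0⟩ := rfl
@[simp] theorem snd_imJ : (imJ K a b c).2 = 0 := rfl
@[simp] theorem fst_imK : (imK K a b c).1 = ⟨0, 0, 0, 1⟩ := rfl
@[simp] theorem snd_imK : (imK K a b c).2 = 0 := rfl

theorem star_imI : star (imI K a b c) = -imI K a b c := by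
  ext <;> simp

theorem imI_mul_imI_mul (x : OctonionAlgebra K a b c) :
    imI K a b c * (imI K a b c * x) = a • x := by
  ext <;> simp

theorem imJ_commutator_imK :
    imJ K a b c * imK K a b c - imK K a b c * imJ K a b c = (-2 * b) • imI K a b c := by
  ext <;> simp
  ring

/-- Commutation with `i` kills `1` and `i`. The other six basis elements anticommute with `i`, so
there it is twice left multiplication by `i`, with square `4 * a`. The witnesses cancel the
components of `x` along `1` and `i`. -/
theorem exists_imI_double_commutator (x : OctonionAlgebra K a b c) :
    ∃ s t : K, imI K a b c * (imI K a b c * x - x * imI K a b c)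
      - (imI K a b c * x - x * imI K a b c) * imI K a b c =
        (4 * a) • x + s • (1 : OctonionAlgebra K a b c) + t • imI K a b c := by
  refine ⟨-4 * a * x.1.re, -4 * a * x.1.imI, ?_⟩
  ext <;> simp <;> ring

end OctonionAlgebra

theorem Matrix.single_sub_single {m R : Type*} [DecidableEq m] [AddCommGroup R] (i j : m) (x y : R) :
    single i j x - single i j y = single i j (x - y) :=
  (map_sub (singleAddMonoidHom i j) x y).symm

/-! ### The trace form on all octonionic matrices. -/

namespace OctonionMatrix

open Matrix OctonionAlgebra

section TraceForm

variable {K : Type*} [Field K] {a b c : K} {n : ℕ}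

/-- The bilinear form `(X, Y) ↦ Tr(X Y + \overline{X Y})` with values in `K`. -/
def scalarTraceForm : LinearMap.BilinForm K (OctonionMatrix K a b c n) :=
  LinearMap.mk₂ K (fun X Y => tr (trace (X * Y)))
    (fun X X' Y => by rw [Matrix.add_mul, trace_add, map_add])
    (fun t X Y => by rw [Matrix.smul_mul, trace_smul, map_smul])
    (fun X Y Y' => by rw [Matrix.mul_add, trace_add, map_add])
    (fun t X Y => by rw [Matrix.mul_smul, trace_smul, map_smul])

theorem scalarTraceForm_apply (X Y : OctonionMatrix K a b c n) :
    scalarTraceForm X Y = tr (trace (X * Y)) := rfl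

theorem scalarTraceForm_smul_one (X Y : OctonionMatrix K a b c n) :
    scalarTraceForm X Y • (1 : OctonionAlgebra K a b c) = traceForm X Y := by
  rw [scalarTraceForm_apply, tr_smul_one, traceForm, trace_add]
  congr 1
  simp [trace, OctonionMatrix.conj, star_sum]

theorem scalarTraceForm_comm (X Y : OctonionMatrix K a b c n) :
    scalarTraceForm X Y = scalarTraceForm Y X := by
  simp only [scalarTraceForm_apply, trace, diag_apply, mul_apply, map_sum]
  rw [Finset.sum_comm]
  simp only [tr_mul_comm]

theorem scalarTraceForm_mul_left (X Y Z : OctonionMatrix K a b c n) :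
    scalarTraceForm (X * Y) Z = scalarTraceForm X (Y * Z) := by
  simp only [scalarTraceForm_apply, trace, diag_apply, mul_apply, map_sum, Finset.sum_mul,
    Finset.mul_sum, tr_mul_assoc]
  exact Finset.sum_congr rfl fun _ _ => Finset.sum_comm

theorem scalarTraceForm_mul_rotate (X Y Z : OctonionMatrix K a b c n) :
    scalarTraceForm (Y * X) Z = scalarTraceForm X (Z * Y) := by
  rw [scalarTraceForm_mul_left, scalarTraceForm_comm, scalarTraceForm_mul_left]

end TraceForm

end OctonionMatrix

open Matrix OctonionAlgebra OctonionMatrix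

/-! ### Reduction of bilinear forms to matrix positions. -/

section Forms

/-- A symmetric relation between unordered pairs of indices holds everywhere as soon as it holds
in the three typical positions. -/
theorem pairRelation_of_cases {ι : Type*} (R : ι → ι → ι → ι → Prop)
    (hsymm : ∀ {i j k l}, R i j k l → R k l i j) (hswap : ∀ {i j k l}, R j i k l → R i j k l)
    (hdisj : ∀ {i j k l}, i ≠ j → i ≠ k → i ≠ l → R i j k l)
    (hoff : ∀ {i j}, i ≠ j → R i j i j) (hdiag : ∀ i k, R i i k k) (i j k l : ι) :
    R i j k l := by
  have key : ∀ {i j : ι}, i ≠ j → ∀ k l, R i j k l := by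
    intro i j hij k l
    by_cases hi : i ≠ k ∧ i ≠ l
    · exact hdisj hij hi.1 hi.2
    by_cases hj : j ≠ k ∧ j ≠ l
    · exact hswap (hdisj hij.symm hj.1 hj.2)
    -- Both of the distinct indices `i`, `j` now occur among `k`, `l`, so the unordered pairs
    -- coincide.
    obtain ⟨rfl, rfl⟩ | ⟨rfl, rfl⟩ : (i = k ∧ j = l) ∨ (j = k ∧ i = l) := by grind
    · exact hoff hij
    · exact hswap (hoff hij.symm)
  by_cases hij : i = j
  · by_cases hkl : k = l
    · subst hij hkl; exact hdiag i k
    · exact hsymm (key hkl i j)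
  · exact key hij k l

/-- A bilinear form vanishes if it vanishes on elements into whose sums all doubles decompose. -/
theorem bilinForm_eq_zero_of_two_smul_eq_sum {K A O ι : Type*} [Field K] (h2 : (2 : K) ≠ 0)
    [AddCommGroup A] [Module K A] [Fintype ι] (s : ι → ι → O → A)
    (hs : ∀ X : A, ∃ x : ι → ι → O, (2 : K) • X = ∑ i, ∑ j, s i j (x i j))
    {φ : LinearMap.BilinForm K A} (h : ∀ i j k l x y, φ (s i j x) (s k l y) = 0) : φ = 0 := by
  refine LinearMap.ext₂ fun X Y => ?_
  obtain ⟨x, hx⟩ := hs X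
  obtain ⟨y, hy⟩ := hs Y
  have : φ ((2 : K) • X) ((2 : K) • Y) = 0 := by
    rw [hx, hy]
    simp [h]
  simpa [h2] using this

end Forms

/-! ### Hermitian matrices: Peirce decomposition. -/

section Hermitian

variable {K : Type*} [Field K] {a b c : K} {n : ℕ}

theorem hermitianOct.coe_mul (X Y : hermitianOct K a b c n) :
    ((X * Y : hermitianOct K a b c n) : OctonionMatrix K a b c n) =
      (2 : K)⁻¹ • (X.1 * Y.1 + Y.1 * X.1) := rfl

theorem skewHermitianOct.coe_mul (X Y : skewHermitianOct K a b c n) :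
    ((X * Y : skewHermitianOct K a b c n) : OctonionMatrix K a b c n) =
      X.1 * Y.1 - Y.1 * X.1 := rfl

theorem hermitianOct.isSymmAssocForm_scalarTraceForm :
    IsSymmAssocForm ((scalarTraceForm (K := K) (a := a) (b := b) (c := c) (n := n)).restrict
      (hermitianOct K a b c n)) := by
  refine ⟨fun X Y => scalarTraceForm_comm _ _, fun X Y Z => ?_⟩
  simp only [LinearMap.BilinForm.restrict_apply, LinearMap.domRestrict_apply,
    hermitianOct.coe_mul, map_smul, map_add, LinearMap.smul_apply, LinearMap.add_apply]
  rw [scalarTraceForm_mul_left, scalarTraceForm_mul_rotate]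

theorem skewHermitianOct.isSymmAssocForm_scalarTraceForm :
    IsSymmAssocForm ((scalarTraceForm (K := K) (a := a) (b := b) (c := c) (n := n)).restrict
      (skewHermitianOct K a b c n)) := by
  refine ⟨fun X Y => scalarTraceForm_comm _ _, fun X Y Z => ?_⟩
  simp only [LinearMap.BilinForm.restrict_apply, LinearMap.domRestrict_apply,
    skewHermitianOct.coe_mul, map_sub, LinearMap.sub_apply]
  rw [scalarTraceForm_mul_left, scalarTraceForm_mul_rotate]

theorem IsSymmAssocForm.sub_smul {A : Type*} [AddCommGroup A] [Module K A] [Mul A]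
    {φ ψ : LinearMap.BilinForm K A} (hφ : IsSymmAssocForm φ) (hψ : IsSymmAssocForm ψ) (t : K) :
    IsSymmAssocForm (φ - t • ψ) :=
  ⟨fun x y => by simp [hφ.1 x y, hψ.1 x y], fun x y z => by simp [hφ.2 x y z, hψ.2 x y z]⟩

/-- If symmetric associative forms are determined by their value at `(e, e)`, then all of them are
multiples of any one that does not vanish there. -/
theorem IsSymmAssocForm.exists_eq_smul {A : Type*} [AddCommGroup A] [Module K A] [Mul A]
    {ψ : LinearMap.BilinForm K A} (hψ : IsSymmAssocForm ψ) (e : A) (he : ψ e e ≠ 0)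
    (h : ∀ φ : LinearMap.BilinForm K A, IsSymmAssocForm φ → φ e e = 0 → φ = 0)
    {φ : LinearMap.BilinForm K A} (hφ : IsSymmAssocForm φ) : ∃ t : K, φ = t • ψ :=
  ⟨φ e e / ψ e e, sub_eq_zero.1 <| h _ (hφ.sub_smul hψ _) (by simp [he])⟩

namespace hermitianOct

/-- The Hermitian matrix `x Eᵢⱼ + x̄ Eⱼᵢ`. -/
def symmSingle (i j : Fin n) : OctonionAlgebra K a b c →ₗ[K] hermitianOct K a b c n where
  toFun x := ⟨single i j x + single j i (star x), by
    change conjTranspose _ = _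
    rw [conjTranspose_add, conjTranspose_single, conjTranspose_single, star_star, add_comm]⟩
  map_add' x y := Subtype.ext <| by
    simp [single_add]; abel
  map_smul' t x := Subtype.ext <| by
    simp [star_smul', smul_single]

theorem coe_symmSingle (i j : Fin n) (x : OctonionAlgebra K a b c) :
    (symmSingle i j x : OctonionMatrix K a b c n) = single i j x + single j i (star x) := rfl

theorem symmSingle_swap (i j : Fin n) (x : OctonionAlgebra K a b c) :
    symmSingle i j x = symmSingle j i (star x) :=
  Subtype.ext <| by simp [coe_symmSingle, add_comm]

/-- Summing over all ordered pairs counts every entry twice, which avoids ordering the indices and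
treating the diagonal apart. -/
theorem two_smul_eq_sum (X : hermitianOct K a b c n) :
    (2 : K) • X = ∑ i, ∑ j, symmSingle i j (X.1 i j) := by
  have hX : X.1.conjTranspose = X.1 := X.2
  refine Subtype.ext ?_
  have hsum : X.1 = ∑ i, ∑ j, single i j (X.1 i j) := matrix_eq_sum_single X.1
  have hsum' : X.1 = ∑ i, ∑ j, single j i (star (X.1 i j)) := by
    conv_lhs => rw [← hX, hsum]
    simp [conjTranspose_sum]
  simp only [Submodule.coe_smul, Submodule.coe_sum, coe_symmSingle, Finset.sum_add_distrib]
  rw [← hsum, ← hsum', two_smul]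

theorem symmSingle_self (h2 : (2 : K) ≠ 0) (i : Fin n) (x : OctonionAlgebra K a b c) :
    symmSingle i i x = (tr x / 2) • symmSingle i i (1 : OctonionAlgebra K a b c) := by
  refine Subtype.ext ?_
  have h : x + star x = (tr x / 2) • (1 + 1 : OctonionAlgebra K a b c) := by
    rw [← tr_smul_one, ← two_smul K (1 : OctonionAlgebra K a b c), smul_smul,
      div_mul_cancel₀ _ h2]
  rw [coe_symmSingle, Submodule.coe_smul, coe_symmSingle, ← single_add, ← single_add, star_one,
    smul_single, h]

theorem diag_mul_diag (h2 : (2 : K) ≠ 0) (i : Fin n) :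
    symmSingle i i (1 : OctonionAlgebra K a b c) * symmSingle i i 1 =
      (2 : K) • symmSingle i i 1 := by
  refine Subtype.ext ?_
  simp only [coe_mul, Submodule.coe_smul, coe_symmSingle, star_one, add_mul, mul_add,
    single_mul_single_same, mul_one]
  rw [← two_smul K, ← two_smul K, smul_smul, smul_smul, inv_mul_cancel₀ h2, one_mul]

/-- The diagonal element is `2 Eᵢᵢ`, and the Peirce eigenvalue `1/2` of `Eᵢᵢ` becomes `1`. -/
theorem diag_mul_offDiag (h2 : (2 : K) ≠ 0) {i j : Fin n} (hij : i ≠ j)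
    (x : OctonionAlgebra K a b c) :
    symmSingle i i 1 * symmSingle i j x = symmSingle i j x := by
  refine Subtype.ext ?_
  simp [coe_mul, coe_symmSingle, add_mul, mul_add, hij, hij.symm]
  rw [← single_add, ← single_add, ← add_smul, ← add_smul, ← two_mul, mul_inv_cancel₀ h2,
    one_smul, one_smul]

theorem diag_mul_of_ne {i k l : Fin n} (hik : i ≠ k) (hil : i ≠ l)
    (x : OctonionAlgebra K a b c) :
    symmSingle i i 1 * symmSingle k l x = 0 := by
  refine Subtype.ext ?_
  simp [coe_mul, coe_symmSingle, add_mul, mul_add, hik, hil, hik.symm, hil.symm]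

theorem offDiag_mul_offDiag {i j : Fin n} (hij : i ≠ j) (x y : OctonionAlgebra K a b c) :
    symmSingle i j x * symmSingle i j y =
      (2 : K)⁻¹ • (symmSingle i i (x * star y) + symmSingle j j (star x * y)) := by
  refine Subtype.ext ?_
  simp [coe_mul, coe_symmSingle, add_mul, mul_add, hij, hij.symm]
  abel

theorem mul_comm' (X Y : hermitianOct K a b c n) : X * Y = Y * X :=
  Subtype.ext <| by rw [coe_mul, coe_mul, add_comm]

theorem eq_zero_of_diag_eq_zero (h2 : (2 : K) ≠ 0) (k : Fin n)
    (φ : LinearMap.BilinForm K (hermitianOct K a b c n)) (hφ : IsSymmAssocForm φ)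
    (hk : φ (symmSingle k k 1) (symmSingle k k 1) = 0) : φ = 0 := by
  obtain ⟨hsymm, hassoc⟩ := hφ
  have hdd {i j : Fin n} (hij : i ≠ j) : φ (symmSingle i i 1) (symmSingle j j 1) = 0 := by
    have h := hassoc (symmSingle i i 1) (symmSingle i i 1) (symmSingle j j 1)
    rw [diag_mul_diag h2, diag_mul_of_ne hij hij] at h
    simpa [h2] using h
  have hd (j : Fin n) : φ (symmSingle j j 1) (symmSingle j j 1) = 0 := by
    obtain rfl | hkj := eq_or_ne k j
    · exact hk
    -- The `ij` element for `1` is symmetric in `i` and `j`, so computing its value from either end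
    -- makes the two diagonal values equal.
    have h : ∀ {i j : Fin n}, i ≠ j → φ (symmSingle i j 1) (symmSingle i j 1) =
        2⁻¹ * φ (symmSingle i i 1) (symmSingle i i 1) := by
      intro i j hij
      have h := hassoc (symmSingle i j 1) (symmSingle i j 1) (symmSingle i i 1)
      rw [mul_comm' _ (symmSingle i i 1), diag_mul_offDiag h2 hij, offDiag_mul_offDiag hij] at h
      rw [← h]
      simp [hdd hij.symm]
    have h' := h hkj.symm
    rw [symmSingle_swap j k, star_one, h hkj, hk] at h'
    simpa [h2] using h'.symm
  have hdiag (i j : Fin n) (x y : OctonionAlgebra K a b c) :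
      φ (symmSingle i i x) (symmSingle j j y) = 0 := by
    rw [symmSingle_self h2 i, symmSingle_self h2 j]
    obtain rfl | hij := eq_or_ne i j
    · simp [hd]
    · simp [hdd hij]
  refine bilinForm_eq_zero_of_two_smul_eq_sum h2 (fun i j => symmSingle i j)
    (fun X => ⟨_, two_smul_eq_sum X⟩) (pairRelation_of_cases (fun i j k l => ∀ x y,
      φ (symmSingle i j x) (symmSingle k l y) = 0) ?_ ?_ ?_ ?_ hdiag)
  · exact fun h x y => by rw [hsymm, h]
  · exact fun h x y => by rw [symmSingle_swap, h]
  · intro i j k l hij hik hil x y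
    rw [← diag_mul_offDiag h2 hij, mul_comm', hassoc, diag_mul_of_ne hik hil, map_zero]
  · intro i j hij x y
    -- Moving the diagonal factor out leaves a product of two `ij` elements, which is diagonal.
    rw [← diag_mul_offDiag h2 hij y, mul_comm', ← hassoc, offDiag_mul_offDiag hij]
    simp [hdiag]

theorem scalarTraceForm_diag_one (i : Fin n) :
    scalarTraceForm (symmSingle i i (1 : OctonionAlgebra K a b c)).1 (symmSingle i i 1).1 = 8 := by
  rw [scalarTraceForm_apply, coe_symmSingle, ← single_add, single_mul_single_same,
    trace_single_eq_same, tr_apply]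
  simp [mul_add]
  norm_num

end hermitianOct

end Hermitian

/-! ### Skew-Hermitian matrices: imaginary octonions on the diagonal. -/

section SkewHermitian

variable {K : Type*} [Field K] {a b c : K} {n : ℕ}

namespace skewHermitianOct

/-- The skew-Hermitian matrix `x Eᵢⱼ - x̄ Eⱼᵢ`. -/
def skewSingle (i j : Fin n) : OctonionAlgebra K a b c →ₗ[K] skewHermitianOct K a b c n where
  toFun x := ⟨single i j x - single j i (star x), by
    change conjTranspose _ = _
    rw [conjTranspose_sub, conjTranspose_single, conjTranspose_single, star_star, neg_sub]⟩
  map_add' x y := Subtype.ext <| by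
    simp [single_add]; abel
  map_smul' t x := Subtype.ext <| by
    simp [star_smul', smul_single, smul_sub]

theorem coe_skewSingle (i j : Fin n) (x : OctonionAlgebra K a b c) :
    (skewSingle i j x : OctonionMatrix K a b c n) = single i j x - single j i (star x) := rfl

theorem skewSingle_swap (i j : Fin n) (x : OctonionAlgebra K a b c) :
    skewSingle i j x = -skewSingle j i (star x) :=
  Subtype.ext <| by simp [coe_skewSingle]

theorem two_smul_eq_sum (X : skewHermitianOct K a b c n) :
    (2 : K) • X = ∑ i, ∑ j, skewSingle i j (X.1 i j) := by
  have hX : X.1.conjTranspose = -X.1 := X.2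
  refine Subtype.ext ?_
  have hsum : X.1 = ∑ i, ∑ j, single i j (X.1 i j) := matrix_eq_sum_single X.1
  have hsum' : -X.1 = ∑ i, ∑ j, single j i (star (X.1 i j)) := by
    conv_lhs => rw [← hX, hsum]
    simp [conjTranspose_sum]
  simp only [Submodule.coe_smul, Submodule.coe_sum, coe_skewSingle, Finset.sum_sub_distrib]
  rw [← hsum, ← hsum', two_smul, sub_neg_eq_add]

theorem skewSingle_self_one (i : Fin n) :
    skewSingle i i (1 : OctonionAlgebra K a b c) = 0 :=
  Subtype.ext <| by simp [coe_skewSingle]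

/-- The diagonal entry is `x - x̄`, twice the imaginary part of `x`. Scalars drop out of
commutators, and a commutator is itself imaginary, so one factor `2` remains. -/
theorem diag_mul_diag (i : Fin n) (x y : OctonionAlgebra K a b c) :
    skewSingle i i x * skewSingle i i y = (2 : K) • skewSingle i i (x * y - y * x) := by
  refine Subtype.ext ?_
  have h : (x - star x) * (y - star y) - (y - star y) * (x - star x) =
      (2 : K) • ((x * y - y * x) - star (x * y - y * x)) := by
    rw [eq_sub_of_add_eq' (tr_smul_one x).symm, eq_sub_of_add_eq' (tr_smul_one y).symm,
      star_sub, star_mul, star_mul,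
      eq_sub_of_add_eq' (tr_smul_one x).symm, eq_sub_of_add_eq' (tr_smul_one y).symm]
    simp only [sub_mul, mul_sub, smul_mul_assoc, mul_smul_comm, one_mul, mul_one]
    module
  simp only [coe_mul, Submodule.coe_smul, coe_skewSingle, single_sub_single, single_mul_single_same,
    smul_single, h]

theorem diag_mul_offDiag {i j : Fin n} (hij : i ≠ j) (x y : OctonionAlgebra K a b c) :
    skewSingle i i x * skewSingle i j y = skewSingle i j ((x - star x) * y) := by
  refine Subtype.ext ?_
  simp [coe_mul, coe_skewSingle, sub_mul, mul_sub, hij, hij.symm]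
  abel

theorem offDiag_mul_offDiag {i j : Fin n} (hij : i ≠ j) (x y : OctonionAlgebra K a b c) :
    skewSingle i j x * skewSingle i j y =
      skewSingle i i (y * star x) + skewSingle j j (star y * x) := by
  refine Subtype.ext ?_
  simp [coe_mul, coe_skewSingle, sub_mul, mul_sub, hij, hij.symm]
  abel

theorem diag_mul_of_ne {i k l : Fin n} (hik : i ≠ k) (hil : i ≠ l)
    (x y : OctonionAlgebra K a b c) :
    skewSingle i i x * skewSingle k l y = 0 := by
  refine Subtype.ext ?_
  simp [coe_mul, coe_skewSingle, sub_mul, mul_sub, hik, hil, hik.symm, hil.symm]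

theorem mul_comm_neg (X Y : skewHermitianOct K a b c n) : X * Y = -(Y * X) :=
  Subtype.ext <| by simp [coe_mul]

theorem mul_neg' (X Y : skewHermitianOct K a b c n) : X * -Y = -(X * Y) :=
  Subtype.ext <| by simp [coe_mul, sub_eq_add_neg, add_comm]

/-- For `a ≠ 0` and `2 ≠ 0`, this exhibits every `ij` element as a product with a fixed diagonal
element, the substitute for the Peirce idempotent. -/
theorem diag_imI_mul_offDiag {i j : Fin n} (hij : i ≠ j) (x : OctonionAlgebra K a b c) :
    skewSingle i i (imI K a b c) * skewSingle i j (imI K a b c * x) =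
      (2 * a) • skewSingle i j x := by
  rw [diag_mul_offDiag hij, star_imI, sub_neg_eq_add, add_mul, imI_mul_imI_mul, ← add_smul,
    map_smul, two_mul]

/-- A linear map on the octonions that vanishes on `1` and on commutators is zero. -/
theorem _root_.OctonionAlgebra.linearMap_eq_zero_of_commutator (h2 : (2 : K) ≠ 0) (ha : a ≠ 0)
    (hb : b ≠ 0) {M : Type*} [AddCommGroup M] [Module K M]
    {f : OctonionAlgebra K a b c →ₗ[K] M} (h1 : f 1 = 0)
    (h : ∀ x y, f (x * y - y * x) = 0) : f = 0 := by
  -- The double commutator recovers `x` only modulo `1` and `i`, so `i` must be obtained as a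
  -- commutator separately.
  have hI : f (imI K a b c) = 0 := by
    have := h (imJ K a b c) (imK K a b c)
    rw [imJ_commutator_imK, map_smul] at this
    simpa [h2, hb] using this
  have h4 : (4 : K) ≠ 0 := by
    rw [show (4 : K) = 2 * 2 by norm_num]; exact mul_ne_zero h2 h2
  refine LinearMap.ext fun x => ?_
  obtain ⟨s, t, hst⟩ := exists_imI_double_commutator x
  have := h (imI K a b c) (imI K a b c * x - x * imI K a b c)
  rw [hst] at this
  simpa [h1, hI, h4, ha] using this

theorem eq_zero_of_diag_imI_eq_zero (h2 : (2 : K) ≠ 0) (ha : a ≠ 0) (hb : b ≠ 0) (k : Fin n)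
    (φ : LinearMap.BilinForm K (skewHermitianOct K a b c n)) (hφ : IsSymmAssocForm φ)
    (hk : φ (skewSingle k k (imI K a b c)) (skewSingle k k (imI K a b c)) = 0) : φ = 0 := by
  obtain ⟨hsymm, hassoc⟩ := hφ
  have h4 : (4 : K) ≠ 0 := by
    rw [show (4 : K) = 2 * 2 by norm_num]; exact mul_ne_zero h2 h2
  have hoff_left {i j : Fin n} (hij : i ≠ j) {Y : skewHermitianOct K a b c n}
      (hY : skewSingle i i (imI K a b c) * Y = 0) (x : OctonionAlgebra K a b c) :
      φ (skewSingle i j x) Y = 0 := by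
    have h := hassoc (skewSingle i j (imI K a b c * x)) (skewSingle i i (imI K a b c)) Y
    rw [hY, map_zero, mul_comm_neg, diag_imI_mul_offDiag hij] at h
    simpa [h2, ha] using h
  have hdisj {i j k l : Fin n} (hij : i ≠ j) (hik : i ≠ k) (hil : i ≠ l)
      (x y : OctonionAlgebra K a b c) : φ (skewSingle i j x) (skewSingle k l y) = 0 :=
    hoff_left hij (diag_mul_of_ne hik hil _ _) x
  have hdiag_comm (i : Fin n) (x y z : OctonionAlgebra K a b c) :
      φ (skewSingle i i (x * y - y * x)) (skewSingle i i z) =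
        φ (skewSingle i i x) (skewSingle i i (y * z - z * y)) := by
    have h := hassoc (skewSingle i i x) (skewSingle i i y) (skewSingle i i z)
    rw [diag_mul_diag, diag_mul_diag] at h
    simpa [h2] using h
  have hdd {i j : Fin n} (hij : i ≠ j) (x y : OctonionAlgebra K a b c) :
      φ (skewSingle i i x) (skewSingle j j y) = 0 := by
    -- Commutators at place `i` are orthogonal to place `j`, and together with `1` they span the
    -- octonions.
    have h : (φ.flip (skewSingle j j y)).comp (skewSingle i i) = 0 := by
      refine linearMap_eq_zero_of_commutator h2 ha hb ?_ fun x x' => ?_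
      · simp [skewSingle_self_one]
      · have h := hassoc (skewSingle i i x) (skewSingle i i x') (skewSingle j j y)
        rw [diag_mul_diag, diag_mul_of_ne hij hij] at h
        simpa [h2] using h
    exact LinearMap.congr_fun h x
  have hkk (x y : OctonionAlgebra K a b c) : φ (skewSingle k k x) (skewSingle k k y) = 0 := by
    -- Moving one `i` across gives `φ([i,i], [i,z]) = φ(i, [i,[i,z]])`, whose left side is zero; the
    -- right side is `4 * a` times the wanted value, since `φ(i,i) = 0`.
    have hI (z : OctonionAlgebra K a b c) :
        φ (skewSingle k k (imI K a b c)) (skewSingle k k z) = 0 := by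
      obtain ⟨s, t, hst⟩ := exists_imI_double_commutator z
      have h := hdiag_comm k (imI K a b c) (imI K a b c) (imI K a b c * z - z * imI K a b c)
      rw [hst] at h
      simpa [skewSingle_self_one, hk, h4, ha] using h
    obtain ⟨s, t, hst⟩ := exists_imI_double_commutator x
    have h := hdiag_comm k (imI K a b c) (imI K a b c * x - x * imI K a b c) y
    rw [hst, hI] at h
    simpa [skewSingle_self_one, hI, h4, ha] using h
  have hoff_of_diag {i j : Fin n} (hij : i ≠ j)
      (hi : ∀ x y : OctonionAlgebra K a b c, φ (skewSingle i i x) (skewSingle i i y) = 0)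
      (x y : OctonionAlgebra K a b c) : φ (skewSingle i j x) (skewSingle i j y) = 0 := by
    have h := hassoc (skewSingle i j x) (skewSingle i j (imI K a b c * y))
      (skewSingle i i (imI K a b c))
    rw [offDiag_mul_offDiag hij, mul_comm_neg _ (skewSingle i i _), diag_imI_mul_offDiag hij,
      map_add, LinearMap.add_apply, hi, hdd hij.symm] at h
    simpa [h2, ha] using h
  have hdiag_of_off {i j : Fin n} (hij : i ≠ j)
      (h : ∀ x y : OctonionAlgebra K a b c, φ (skewSingle i j x) (skewSingle i j y) = 0)
      (x y : OctonionAlgebra K a b c) : φ (skewSingle j j x) (skewSingle j j y) = 0 := by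
    -- The product of the first two has `jj` part given by `x`, its `ii` part being orthogonal to
    -- place `j`; the product of the last two stays off-diagonal.
    have h' := hassoc (skewSingle i j x) (skewSingle i j 1) (skewSingle j j y)
    rw [offDiag_mul_offDiag hij, skewSingle_swap i j 1, mul_comm_neg _ (skewSingle j j _),
      mul_neg', neg_neg, diag_mul_offDiag hij.symm, skewSingle_swap j i, map_neg, h] at h'
    simpa [hdd hij] using h'
  have hd (j : Fin n) (x y : OctonionAlgebra K a b c) :
      φ (skewSingle j j x) (skewSingle j j y) = 0 := by
    obtain rfl | hkj := eq_or_ne k j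
    · exact hkk x y
    · exact hdiag_of_off hkj (hoff_of_diag hkj hkk) x y
  refine bilinForm_eq_zero_of_two_smul_eq_sum h2 (fun i j => skewSingle i j)
    (fun X => ⟨_, two_smul_eq_sum X⟩) (pairRelation_of_cases (fun i j k l => ∀ x y,
      φ (skewSingle i j x) (skewSingle k l y) = 0) ?_ ?_ hdisj ?_ ?_)
  · exact fun h x y => by rw [hsymm, h]
  · exact fun h x y => by rw [skewSingle_swap, map_neg, LinearMap.neg_apply, h, neg_zero]
  · exact fun hij => hoff_of_diag hij (hd _)
  · intro i j x y
    obtain rfl | hij := eq_or_ne i j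
    · exact hd i x y
    · exact hdd hij x y

theorem scalarTraceForm_diag_imI (i : Fin n) :
    scalarTraceForm (skewSingle i i (imI K a b c)).1 (skewSingle i i (imI K a b c)).1 =
      8 * a := by
  rw [scalarTraceForm_apply, coe_skewSingle, single_sub_single, single_mul_single_same,
    trace_single_eq_same, tr_apply, star_imI]
  simp
  ring

end skewHermitianOct

end SkewHermitian

theorem theorem3 (K : Type*) [Field K] (h2 : (2 : K) ≠ 0) (h3 : (3 : K) ≠ 0)
    (a b c : K) (ha : a ≠ 0) (hb : b ≠ 0) (hc : c ≠ 0) (n : ℕ) :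
    (∃ B : LinearMap.BilinForm K (hermitianOct K a b c n),
      (∀ X Y : hermitianOct K a b c n,
        B X Y • (1 : OctonionAlgebra K a b c) = OctonionMatrix.traceForm X.1 Y.1) ∧
      IsSymmAssocForm B ∧
      ∀ φ : LinearMap.BilinForm K (hermitianOct K a b c n),
        IsSymmAssocForm φ → ∃ t : K, φ = t • B) ∧
    (∃ B : LinearMap.BilinForm K (skewHermitianOct K a b c n),
      (∀ X Y : skewHermitianOct K a b c n,
        B X Y • (1 : OctonionAlgebra K a b c) = OctonionMatrix.traceForm X.1 Y.1) ∧
      IsSymmAssocForm B ∧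
      ∀ φ : LinearMap.BilinForm K (skewHermitianOct K a b c n),
        IsSymmAssocForm φ → ∃ t : K, φ = t • B) := by
  have h8 : (8 : K) ≠ 0 := by
    rw [show (8 : K) = 2 ^ 3 by norm_num]; exact pow_ne_zero 3 h2
  refine ⟨⟨scalarTraceForm.restrict _, fun X Y => scalarTraceForm_smul_one X.1 Y.1,
    hermitianOct.isSymmAssocForm_scalarTraceForm, fun φ hφ => ?_⟩,
    ⟨scalarTraceForm.restrict _, fun X Y => scalarTraceForm_smul_one X.1 Y.1,
    skewHermitianOct.isSymmAssocForm_scalarTraceForm, fun φ hφ => ?_⟩⟩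
  · obtain _ | n := n
    -- For `n = 0` there is no diagonal element to normalize at, but the algebra is zero.
    · exact ⟨0, LinearMap.ext fun X => by rw [Subsingleton.elim X 0, map_zero, map_zero]⟩
    · refine hermitianOct.isSymmAssocForm_scalarTraceForm.exists_eq_smul
        (hermitianOct.symmSingle 0 0 1) ?_ (hermitianOct.eq_zero_of_diag_eq_zero h2 0) hφ
      exact (hermitianOct.scalarTraceForm_diag_one 0).trans_ne h8
  · obtain _ | n := n
    · exact ⟨0, LinearMap.ext fun X => by rw [Subsingleton.elim X 0, map_zero, map_zero]⟩
    · refine skewHermitianOct.isSymmAssocForm_scalarTraceForm.exists_eq_smul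
        (skewHermitianOct.skewSingle 0 0 (imI K a b c)) ?_
        (skewHermitianOct.eq_zero_of_diag_imI_eq_zero h2 ha hb 0) hφ
      exact (skewHermitianOct.scalarTraceForm_diag_imI 0).trans_ne (mul_ne_zero h8 ha)
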